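/- Let $n\ge 1$, let $F_n$ be the free group with basis $x_0,\dots,x_{n-1}$ (subscripts modulo $n$), and let $\theta\colon F_n\to F_n$ be the automorphism with $\theta(x_i)=x_{i+1}$. For a cyclically reduced word $w\in F_n$ let $$P_n(w)=\langle x_0,\dots,x_{n-1}\mid w,\theta(w),\dots,\theta^{n-1}(w)\rangle$$ be the cyclic presentation with defining word $w$, and let $G_n(w)$ be the group it defines. A presentation $\langle X\mid R\rangle$ (where $R$ is a set of elements of the free group on $X$) is called redundant if some $r\in R$ is trivial in the free group, or is conjugate in the free group to $s$ or to $s^{-1}$ for some $s\in R$ with $s\neq r$. A group is called large if it has a finite index subgroup with a non-abelian free homomorphic image. The word $w$ is a proper power if $w=v^p$ for some $v\in F_n$ and $p\ge 2$. The star graph of a presentation $\langle X\mid R\rangle$ with cyclically reduced relators is the multigraph with vertex set $X\cup X^{-1}$ that has one edge joining $x$ and $y$ for each word of the form $xy^{-1}u$ ($x,y\in X\cup X^{-1}$) in the set $\tilde R$ of all cyclic permutations of elements of $R\cup R^{-1}$, where the edges given by $xy^{-1}u$ and $yx^{-1}u^{-1}$ are identified. For $m\ge 2$, $k\ge 3$,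 $\nu\ge 1$, a finite presentation $\langle X\mid R\rangle$ is $(m,k,\nu)$-special if its star graph has exactly $\nu$ connected components, these are pairwise isomorphic, each of them is a connected bipartite graph of diameter $m$ and girth $2m$ in which every vertex has degree at least $3$, every relator has length $k$, and $k\ge 4$ if $m=2$. Theorem. Suppose that $P_n(w)$ is redundant. If $n\ge 3$, or if $n=2$ and $w$ is a proper power, then $G_n(w)$ is large. In particular, if $P_n(w)$ is redundant and $(m,k,\nu)$-special for some $m\ge 2$, $k\ge 3$, $\nu\ge 1$, then $G_n(w)$ is large. -/

import Mathlib

namespace CyclicPres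

universe u v

/-! ### Large groups, proper powers -/

/-- A group is large if it has a finite index subgroup with a non-abelian free homomorphic image.
(An image of a group in `Type u` can always be taken in `Type u`.) -/
def IsLarge (G : Type u) [Group G] : Prop :=
  ∃ H : Subgroup G, H.FiniteIndex ∧
    ∃ (F : Type u) (_ : Group F), IsFreeGroup F ∧ (∃ a b : F, a * b ≠ b * a) ∧
      ∃ f : H →* F, Function.Surjective f

/-- `w` is a proper power. -/
def IsProperPower {G : Type u} [Group G] (w : G) : Prop :=
  ∃ (v : G) (p : ℕ), 2 ≤ p ∧ w = v ^ p

/-! ### Redundant presentations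

A presentation `⟨X | R⟩` is given by its set of relators `R : Set (FreeGroup X)`;
the group it defines is `PresentedGroup R`. -/

/-- The relator `r` of `⟨X | R⟩` is freely redundant: it is trivial in the free group, or freely
conjugate to another relator or to the inverse of another relator. -/
def IsFreelyRedundant {X : Type u} (R : Set (FreeGroup X)) (r : FreeGroup X) : Prop :=
  r = 1 ∨ ∃ s ∈ R, s ≠ r ∧ (IsConj r s ∨ IsConj r s⁻¹)

/-- A presentation is redundant if it contains a freely redundant relator. -/
def IsRedundant {X : Type u} (R : Set (FreeGroup X)) : Prop :=
  ∃ r ∈ R, IsFreelyRedundant R r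

/-! ### Cyclic presentations -/

/-- The shift automorphism `x_i ↦ x_{i+1}` of the free group on `x_i`, `i ∈ ℤ/n`. -/
def shift (n : ℕ) : MulAut (FreeGroup (ZMod n)) :=
  FreeGroup.freeGroupCongr (Equiv.addRight (1 : ZMod n))

/-- The relators `w, θ(w), …, θ^{n-1}(w)` of the cyclic presentation `P_n(w)`. -/
def cyclicRelators (n : ℕ) (w : FreeGroup (ZMod n)) : Set (FreeGroup (ZMod n)) :=
  {r | ∃ i : ℕ, i < n ∧ r = (shift n ^ i) w}

/-- The cyclically presented group `G_n(w)`. -/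
abbrev CyclicGroup (n : ℕ) (w : FreeGroup (ZMod n)) : Type :=
  PresentedGroup (cyclicRelators n w)

/-! ### Multigraphs -/

section Multigraph

variable {α : Type u} {β : Type v}

/-- `(p 0, …, p l)` with the edges `(e 0, …, e (l-1))` is a path of length `l` in `G`. -/
def IsPath (G : Graph α β) (l : ℕ) (p : Fin (l + 1) → α) (e : Fin l → β) : Prop :=
  p 0 ∈ G.vertexSet ∧ ∀ i : Fin l, G.IsLink (e i) (p i.castSucc) (p i.succ)

/-- No edge is followed by itself. -/
def IsReducedPath {l : ℕ} (e : Fin l → β) : Prop :=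
  ∀ i j : Fin l, (j : ℕ) = i + 1 → e i ≠ e j

/-- There is a path of length `l` from `x` to `y`. -/
def JoinedBy (G : Graph α β) (l : ℕ) (x y : α) : Prop :=
  ∃ p e, IsPath G l p e ∧ p 0 = x ∧ p (Fin.last l) = y

/-- The distance between two vertices, `⊤` if no path joins them. -/
noncomputable def edist (G : Graph α β) (x y : α) : ℕ∞ :=
  ⨅ (l : ℕ) (_ : JoinedBy G l x y), (l : ℕ∞)

/-- The greatest distance between two vertices. -/
noncomputable def ediam (G : Graph α β) : ℕ∞ :=
  ⨆ (x ∈ G.vertexSet) (y ∈ G.vertexSet), edist G x y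

/-- The least length of a reduced closed path of positive length, `⊤` if there is none. -/
noncomputable def egirth (G : Graph α β) : ℕ∞ :=
  ⨅ (l : ℕ) (_ : 0 < l ∧ ∃ p e, IsPath G l p e ∧ p 0 = p (Fin.last l) ∧ IsReducedPath e), (l : ℕ∞)

/-- The number of edges at a vertex, loops counted twice. -/
noncomputable def edegree (G : Graph α β) (x : α) : ℕ∞ :=
  {e | G.Inc e x}.encard + {e | G.IsLoopAt e x}.encard

/-- Every edge joins a vertex of `A` to a vertex of `B`, where `A`, `B` partition the vertices. -/
def IsBipartite (G : Graph α β) : Prop :=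
  ∃ A B : Set α, Disjoint A B ∧ A ∪ B = G.vertexSet ∧
    ∀ e x y, G.IsLink e x y → (x ∈ A ∧ y ∈ B) ∨ (x ∈ B ∧ y ∈ A)

/-- `G` is non-empty and any two of its vertices are joined by a path. -/
def IsConnected (G : Graph α β) : Prop :=
  G.vertexSet.Nonempty ∧ ∀ x ∈ G.vertexSet, ∀ y ∈ G.vertexSet, ∃ l, JoinedBy G l x y

/-- The connected components of `G`, as graphs. -/
def components (G : Graph α β) : Set (Graph α β) :=
  {H | ∃ x ∈ G.vertexSet, H = G.induce {y | ∃ l, JoinedBy G l x y}}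

/-- Isomorphism of multigraphs. -/
def AreIsomorphic (H K : Graph α β) : Prop :=
  ∃ (φ : H.vertexSet ≃ K.vertexSet) (ψ : H.edgeSet ≃ K.edgeSet),
    ∀ (e : H.edgeSet) (x y : H.vertexSet), H.IsLink e x y ↔ K.IsLink (ψ e) (φ x) (φ y)

end Multigraph

/-! ### Star graphs

A letter of a word is `(x, true)`, which stands for `x`, or `(x, false)`, which stands for `x⁻¹`. -/

section StarGraph

variable {X : Type u}

/-- The inverse of a letter. -/
def letterInv (a : X × Bool) : X × Bool := (a.1, !a.2)

variable [DecidableEq X]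

/-- The symmetrized closure of `R`: all cyclic permutations of the words in `R ∪ R⁻¹`. -/
def symmetrizedClosure (R : Set (FreeGroup X)) : Set (List (X × Bool)) :=
  {L | ∃ r ∈ R, L.IsRotated r.toWord ∨ L.IsRotated (r⁻¹).toWord}

/-- The inverse `y x⁻¹ u⁻¹` (up to cyclic permutation) of a word `x y⁻¹ u` of the symmetrized
closure again belongs to it. -/
theorem inverse_mem_symmetrizedClosure {R : Set (FreeGroup X)} {x y : X × Bool}
    {u : List (X × Bool)} (h : x :: letterInv y :: u ∈ symmetrizedClosure R) :
    y :: letterInv x :: FreeGroup.invRev u ∈ symmetrizedClosure R := by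
  have key : ∀ L : List (X × Bool), (x :: letterInv y :: u).IsRotated L →
      (y :: letterInv x :: FreeGroup.invRev u).IsRotated (FreeGroup.invRev L) := by
    intro L hL
    have h1 : (FreeGroup.invRev (x :: letterInv y :: u)).IsRotated (FreeGroup.invRev L) :=
      (hL.map _).reverse
    refine List.IsRotated.trans ?_ h1
    have h2 : FreeGroup.invRev (x :: letterInv y :: u)
        = FreeGroup.invRev u ++ [y, letterInv x] := by
      simp [FreeGroup.invRev, letterInv]
    rw [h2]
    exact (List.isRotated_append (l := [y, letterInv x]) (l' := FreeGroup.invRev u))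
  obtain ⟨r, hr, h | h⟩ := h
  · exact ⟨r, hr, Or.inr (by rw [FreeGroup.toWord_inv]; exact key _ h)⟩
  · refine ⟨r, hr, Or.inl ?_⟩
    have := key _ h
    rwa [FreeGroup.toWord_inv, FreeGroup.invRev_invRev] at this

/-- The star graph of `⟨X | R⟩`, for cyclically reduced relators. The vertices are the letters.
Each word `x y⁻¹ u` of the symmetrized closure gives an edge joining `x` and `y`, where the
edges of `x y⁻¹ u` and `y x⁻¹ u⁻¹` are identified: an edge is such an unordered inverse pair. -/
def starGraph (R : Set (FreeGroup X)) : Graph (X × Bool) (Sym2 (List (X × Bool))) where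
  vertexSet := Set.univ
  IsLink e x y := ∃ u : List (X × Bool), x :: letterInv y :: u ∈ symmetrizedClosure R ∧
    e = s(x :: letterInv y :: u, y :: letterInv x :: FreeGroup.invRev u)
  isLink_symm e _ := ⟨fun x y ⟨u, hu, he⟩ =>
    ⟨FreeGroup.invRev u, inverse_mem_symmetrizedClosure hu, by
      rw [he, FreeGroup.invRev_invRev, Sym2.eq_swap]⟩⟩
  eq_or_eq_of_isLink_of_isLink := by
    rintro e x y v w ⟨u, _, rfl⟩ ⟨u', _, he⟩
    simp only [Sym2.eq_iff, List.cons.injEq] at he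
    tauto
  left_mem_of_isLink := fun _ _ _ _ => Set.mem_univ _

/-- `⟨X | R⟩` is an `(m, k, ν)`-special presentation. -/
structure IsSpecial (m k ν : ℕ) (R : Set (FreeGroup X)) : Prop where
  two_le_m : 2 ≤ m
  three_le_k : 3 ≤ k
  one_le_nu : 1 ≤ ν
  finite_generators : Finite X
  finite_relators : R.Finite
  /-- The star graph has `ν` components. -/
  card_components : (components (starGraph R)).encard = ν
  isomorphic : ∀ H ∈ components (starGraph R), ∀ K ∈ components (starGraph R), AreIsomorphic H K
  connected : ∀ H ∈ components (starGraph R), IsConnected H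
  bipartite : ∀ H ∈ components (starGraph R), IsBipartite H
  diameter : ∀ H ∈ components (starGraph R), ediam H = m
  girth : ∀ H ∈ components (starGraph R), egirth H = 2 * m
  degree : ∀ H ∈ components (starGraph R), ∀ x ∈ H.vertexSet, 3 ≤ edegree H x
  /-- Every relator has length `k`. -/
  length : ∀ r ∈ R, r.toWord.length = k
  four_le_k : m = 2 → 4 ≤ k

end StarGraph

end CyclicPres

namespace CyclicPres

universe u

/-! ### Criteria for largeness -/

/-! If `w ≠ 1`, redundancy makes the shift of `w` by some `d ≠ 0` conjugate to `w` or `w⁻¹`. Hence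
one relator per coset of `⟨d⟩` suffices: at most `n / 2`, so at most `n - 2` when `n ≥ 3`. Moreover
the exponent sum in `x_0` minus `±1` times that in `x_d` kills every relator and is `1` on `x_0`
(`exists_height`).

Largeness then follows by a Baumslag–Pride argument. The elements whose height is divisible by `N`
form a subgroup of finite index, to be mapped to the virtually free group `ℤ * ℤ/p`. Such a map
comes from a cocycle `ℤ → ℤ * ℤ/p` for which translation by `N` is conjugation by the generator `T`
of `ℤ`, with generators sent to conjugates of elements of `ℤ/p` (`isLarge_of_cocycle_twist`). If
these values vanish near multiples of `N`, each relator sees a single copy of `ℤ/p`, and the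
conditions become linear over `ℤ/p` (`exists_margin`). Two spare generators leave more unknowns than
equations for large `N` (`isLarge_of_deficiency`); for a `p`-th power the equations are vacuous
(`isLarge_of_properPower`).

A special presentation has at least three generators, by counting vertices of its star graph
(`six_le_encard`). -/

/-- A group is large if a finite index subgroup has a homomorphism to a free group whose image is
not abelian. -/
theorem isLarge_of_hom {G F : Type u} [Group G] [Group F] [IsFreeGroup F] (H : Subgroup G)
    [H.FiniteIndex] (f : H →* F) (a b : H) (hab : f a * f b ≠ f b * f a) : IsLarge G := by
  refine ⟨H, inferInstance, f.range, inferInstance, inferInstance,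
    ⟨f.rangeRestrict a, f.rangeRestrict b, fun h => hab ?_⟩, f.rangeRestrict,
    f.rangeRestrict_surjective⟩
  exact congrArg Subtype.val h

/-- A group with a large finite index subgroup is large. -/
theorem IsLarge.of_finiteIndex {G : Type u} [Group G] (H : Subgroup G) [hH : H.FiniteIndex]
    (h : IsLarge H) : IsLarge G := by
  obtain ⟨K, hK, F, _, hF, hne, f, hf⟩ := h
  let e := K.equivMapOfInjective H.subtype H.subtype_injective
  refine ⟨K.map H.subtype, ⟨?_⟩, F, inferInstance, hF, hne, f.comp e.symm.toMonoidHom,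
    hf.comp e.symm.surjective⟩
  rw [Subgroup.index_map_subtype]
  exact mul_ne_zero hK.index_ne_zero hH.index_ne_zero

/-- A group with a large quotient is large. -/
theorem IsLarge.of_surjective {G Q : Type u} [Group G] [Group Q] (π : G →* Q)
    (hπ : Function.Surjective π) (h : IsLarge Q) : IsLarge G := by
  obtain ⟨K, hK, F, _, hF, hne, f, hf⟩ := h
  refine ⟨K.comap π, ⟨?_⟩, F, inferInstance, hF, hne, f.comp (π.subgroupComap K),
    hf.comp (π.subgroupComap_surjective_of_surjective K hπ)⟩
  rw [Subgroup.index_comap_of_surjective _ hπ]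
  exact hK.index_ne_zero

/-- A group is large if a finite index subgroup maps to an extension of a free group by a finite
group with non-abelian image in the free group. -/
theorem isLarge_of_hom_semidirectProduct {G F K : Type u} [Group G] [Group F] [IsFreeGroup F]
    [Group K] [Finite K] {σ : K →* MulAut F} (H : Subgroup G) [H.FiniteIndex]
    (f : H →* F ⋊[σ] K) (a b : H) {u v : F} (ha : f a = SemidirectProduct.inl u)
    (hb : f b = SemidirectProduct.inl v) (huv : u * v ≠ v * u) : IsLarge G := by
  refine IsLarge.of_finiteIndex H ?_
  let g : H →* K := SemidirectProduct.rightHom.comp f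
  have hg (x : g.ker) : (f x).right = 1 := x.2
  -- On the kernel of the projection to the finite factor the action is trivial, so the free
  -- coordinate is multiplicative.
  let l : g.ker →* F :=
    { toFun := fun x => (f x).left
      map_one' := by simp
      map_mul' := fun x y => by simp [hg x] }
  refine isLarge_of_hom g.ker l ⟨a, ?_⟩ ⟨b, ?_⟩ ?_
  · simp [g, MonoidHom.mem_ker, ha]
  · simp [g, MonoidHom.mem_ker, hb]
  · simpa [l, ha, hb] using huv

/-- A group is large if a presentation whose relators imply its relators defines a large group. -/
theorem IsLarge.of_relators {X : Type u} {R S : Set (FreeGroup X)}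
    (h : IsLarge (PresentedGroup S)) (hRS : ∀ r ∈ R, r ∈ Subgroup.normalClosure S) :
    IsLarge (PresentedGroup R) := by
  have hker : ∀ r ∈ R, FreeGroup.lift (fun x => PresentedGroup.of (rels := S) x) r = 1 := by
    intro r hr
    have : FreeGroup.lift (fun x => PresentedGroup.of (rels := S) x) = PresentedGroup.mk S := by
      ext x; simp [PresentedGroup.of]
    rw [this]
    exact (QuotientGroup.eq_one_iff r).2 (hRS r hr)
  refine IsLarge.of_surjective (PresentedGroup.toGroup hker) ?_ h
  rw [← MonoidHom.range_eq_top, eq_top_iff, ← PresentedGroup.closure_range_of,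
    Subgroup.closure_le]
  rintro _ ⟨x, rfl⟩
  exact ⟨PresentedGroup.of x, by simp⟩

/-! ### Cocycles on free groups -/

section Cocycle

variable {X A : Type*} [Group A]

/-- `ℤ` acts on sequences by translation. -/
def translation (A : Type*) [Group A] : Multiplicative ℤ →* MulAut (ℤ → A) where
  toFun m :=
    { toFun := fun f k => f (k + m.toAdd)
      invFun := fun f k => f (k - m.toAdd)
      left_inv := fun f => by ext k; simp
      right_inv := fun f => by ext k; simp
      map_mul' := fun f g => rfl }
  map_one' := by ext f k; simp
  map_mul' m n := by ext f k; simp [add_assoc]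

theorem translation_apply (m : Multiplicative ℤ) (f : ℤ → A) (k : ℤ) :
    translation A m f k = f (k + m.toAdd) := rfl

/-- The homomorphism from a free group to a wreath product with `ℤ` given by the values `b x` and
the heights `c x` of the generators. -/
def toWreath (c : X → ℤ) (b : X → ℤ → A) :
    FreeGroup X →* (ℤ → A) ⋊[translation A] Multiplicative ℤ :=
  FreeGroup.lift fun x => ⟨b x, Multiplicative.ofAdd (c x)⟩

/-- The homomorphism from a free group to `ℤ` given by the heights `c x` of the generators. -/
def height (c : X → ℤ) : FreeGroup X →* Multiplicative ℤ :=
  FreeGroup.lift fun x => Multiplicative.ofAdd (c x)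

/-- The cocycle on a free group with the values `b x` on the generators. -/
def cocycle (c : X → ℤ) (b : X → ℤ → A) (g : FreeGroup X) : ℤ → A :=
  (toWreath c b g).left

theorem toWreath_right (c : X → ℤ) (b : X → ℤ → A) (g : FreeGroup X) :
    (toWreath c b g).right = height c g := by
  have : SemidirectProduct.rightHom.comp (toWreath c b) = height c := by
    ext x; simp [toWreath, height]
  exact DFunLike.congr_fun this g

theorem height_of (c : X → ℤ) (x : X) : (height c (FreeGroup.of x)).toAdd = c x := by
  simp [height]

theorem cocycle_one (c : X → ℤ) (b : X → ℤ → A) (k : ℤ) : cocycle c b 1 k = 1 := by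
  simp [cocycle]

theorem cocycle_of (c : X → ℤ) (b : X → ℤ → A) (x : X) :
    cocycle c b (FreeGroup.of x) = b x := by
  simp [cocycle, toWreath]

theorem cocycle_mul (c : X → ℤ) (b : X → ℤ → A) (g h : FreeGroup X) (k : ℤ) :
    cocycle c b (g * h) k = cocycle c b g k * cocycle c b h (k + (height c g).toAdd) := by
  simp [cocycle, translation_apply, toWreath_right]

theorem cocycle_inv (c : X → ℤ) (b : X → ℤ → A) (g : FreeGroup X) (k : ℤ) :
    cocycle c b g⁻¹ k = (cocycle c b g (k - (height c g).toAdd))⁻¹ := by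
  have h := cocycle_mul c b g⁻¹ g k
  rw [inv_mul_cancel, cocycle_one] at h
  rw [eq_inv_of_mul_eq_one_left h.symm]
  simp [sub_eq_add_neg]

theorem cocycle_pow (c : X → ℤ) (b : X → ℤ → A) {g : FreeGroup X} (hg : height c g = 1) (m : ℕ)
    (k : ℤ) : cocycle c b (g ^ m) k = cocycle c b g k ^ m := by
  induction m with
  | zero => simp [cocycle_one]
  | succ m ih => rw [pow_succ, cocycle_mul, ih]; simp [hg, pow_succ]

/-- The value of a cocycle at `k` depends only on the values of the generators near `k`. -/
theorem exists_radius (A B : Type*) [Group A] [Group B] (c : X → ℤ) (g : FreeGroup X) :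
    ∃ s : ℕ, ∀ (b : X → ℤ → A) (b' : X → ℤ → B) (η : B →* A) (k : ℤ),
      (∀ j : ℤ, |j| ≤ s → ∀ x, b x (k + j) = η (b' x (k + j))) →
        cocycle c b g k = η (cocycle c b' g k) := by
  induction g using FreeGroup.induction_on with
  | C1 => exact ⟨0, fun b b' η k _ => by simp [cocycle_one]⟩
  | of x => exact ⟨0, fun b b' η k h => by simpa [cocycle_of] using h 0 (by simp) x⟩
  | inv_of x ih =>
    obtain ⟨s, hs⟩ := ih
    refine ⟨s + (c x).natAbs, fun b b' η k h => ?_⟩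
    have := hs b b' η (k - c x) fun j hj y => by
      have := h (j - c x) (by
        push_cast
        exact (abs_sub j (c x)).trans (by linarith)) y
      rwa [show k + (j - c x) = k - c x + j by ring] at this
    simp [cocycle_inv, height_of, this]
  | mul g h hg hh =>
    obtain ⟨s, hs⟩ := hg
    obtain ⟨t, ht⟩ := hh
    set m := (height c g).toAdd with hm
    -- The second factor is read at `k + m`, which shifts its window by the height `m` of the first.
    refine ⟨s + t + m.natAbs, fun b b' η k H => ?_⟩
    have h1 := hs b b' η k fun j hj y => H j (by push_cast; linarith [abs_nonneg m]) y
    have h2 := ht b b' η (k + m) fun j hj y => by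
      have := H (j + m) (by
        push_cast
        exact (abs_add_le j m).trans (by linarith)) y
      rwa [show k + (j + m) = k + m + j by ring] at this
    rw [cocycle_mul, cocycle_mul, h1, ← hm, h2, map_mul]

/-- A cocycle inherits equivariance from its values on the generators. -/
theorem cocycle_equivariant (c : X → ℤ) (b : X → ℤ → A) {T : A} {N : ℤ}
    (hb : ∀ x k, b x (k + N) = T * b x k * T⁻¹) (g : FreeGroup X) (k : ℤ) :
    cocycle c b g (k + N) = T * cocycle c b g k * T⁻¹ := by
  induction g using FreeGroup.induction_on generalizing k with
  | C1 => simp [cocycle_one]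
  | of x => simpa [cocycle_of] using hb x k
  | inv_of x ih =>
    rw [cocycle_inv, cocycle_inv, add_sub_right_comm, ih]; group
  | mul g h hg hh =>
    rw [cocycle_mul, cocycle_mul, add_right_comm, hg, hh]; group

/-- Reduces questions about equivariant sequences to one period. -/
theorem equivariant_mul {f : ℤ → A} {T : A} {N : ℤ} (hf : ∀ k, f (k + N) = T * f k * T⁻¹)
    (q k : ℤ) : f (k + N * q) = T ^ q * f k * (T ^ q)⁻¹ := by
  induction q with
  | zero => simp
  | succ q ih => rw [mul_add, mul_one, ← add_assoc, hf, ih, zpow_add_one]; group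
  | pred q ih =>
    have h := hf (k + N * (-q - 1))
    rw [show k + N * (-(q : ℤ) - 1) + N = k + N * -q by ring, ih] at h
    rw [show f (k + N * (-(q : ℤ) - 1)) = T⁻¹ * (T * f (k + N * (-q - 1)) * T⁻¹) * T by group,
      ← h, zpow_sub_one]
    group

end Cocycle

/-! ### Homomorphisms to `ℤ * ℤ/p` -/

section Twist

/-- Translation of the generators of `FreeGroup (ZMod p)`. -/
def rotation (p : ℕ) : Multiplicative (ZMod p) →* MulAut (FreeGroup (ZMod p)) where
  toFun u := FreeGroup.freeGroupCongr (Equiv.addRight u.toAdd)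
  map_one' := by ext x; simp [FreeGroup.freeGroupCongr]
  map_mul' u v := by
    apply MulEquiv.toMonoidHom_injective
    ext x
    simp [FreeGroup.freeGroupCongr, add_comm, add_left_comm]

theorem rotation_of (p : ℕ) (u : Multiplicative (ZMod p)) (x : ZMod p) :
    rotation p u (FreeGroup.of x) = FreeGroup.of (x + u.toAdd) := by
  simp [rotation, FreeGroup.freeGroupCongr]

/-- The group `ℤ * ℤ/p` as an extension of a free group by `ℤ/p`. -/
abbrev TwistGroup (p : ℕ) : Type :=
  FreeGroup (ZMod p) ⋊[rotation p] Multiplicative (ZMod p)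

/-- The generator of infinite order of `ℤ * ℤ/p`. -/
def twistGen (p : ℕ) : TwistGroup p := SemidirectProduct.inl (FreeGroup.of 0)

variable {X : Type} {p N : ℕ}

/-- The elements of `ℤ/p` given by `α`, conjugated so as to be equivariant with period `N`. -/
def twist (N : ℕ) (α : X → ℤ → ZMod p) (x : X) (k : ℤ) : TwistGroup p :=
  twistGen p ^ (k / N) * SemidirectProduct.inr (Multiplicative.ofAdd (α x k)) *
    (twistGen p ^ (k / N))⁻¹

/-- The exponent `k / N` of the conjugator grows by one per period; this produces the equivariance
that the map to `ℤ * ℤ/p` needs. -/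
theorem twist_add [NeZero N] {α : X → ℤ → ZMod p} (hα : ∀ x k, α x (k + N) = α x k) (x : X)
    (k : ℤ) : twist N α x (k + N) = twistGen p * twist N α x k * (twistGen p)⁻¹ := by
  have hN : (N : ℤ) ≠ 0 := by exact_mod_cast NeZero.ne N
  rw [twist, hα, Int.add_ediv_of_dvd_right dvd_rfl, Int.ediv_self hN, zpow_add_one, twist]
  group

theorem twist_eq_of_lt (α : X → ℤ → ZMod p) (x : X) {k : ℤ} (h0 : 0 ≤ k) (hk : k < N) :
    twist N α x k = SemidirectProduct.inr (Multiplicative.ofAdd (α x k)) := by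
  rw [twist, Int.ediv_eq_zero_of_lt h0 hk]; simp

theorem twist_eq_one {α : X → ℤ → ZMod p} {x : X} {k : ℤ} (h : α x k = 0) :
    twist N α x k = 1 := by
  simp [twist, h]

/-- A presented group is large if the cocycle of some non-zero `α` vanishes on the relators. -/
theorem isLarge_of_cocycle_twist [NeZero N] [NeZero p] {R : Set (FreeGroup X)} {c : X → ℤ}
    {x₀ x₁ : X} (hc : c x₀ = 1) (hR : ∀ r ∈ R, height c r = 1) {α : X → ℤ → ZMod p}
    (hα : ∀ x k, α x (k + N) = α x k) (h₀ : ∀ k, α x₀ k = 0) {k₁ : ℕ} (hk₁ : k₁ < N)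
    (h₁ : α x₁ k₁ ≠ 0) (hkill : ∀ r ∈ R, ∀ k, cocycle c (twist N α) r k = 1) :
    IsLarge (PresentedGroup R) := by
  have hN : (N : ℤ) ≠ 0 := by exact_mod_cast NeZero.ne N
  set b := twist N α with hb
  set T := twistGen p with hT
  have hrel : ∀ r ∈ R, FreeGroup.lift (fun x => (⟨b x, Multiplicative.ofAdd (c x)⟩ :
      (ℤ → TwistGroup p) ⋊[translation (TwistGroup p)] Multiplicative ℤ)) r = 1 := fun r hr =>
    SemidirectProduct.ext (funext (hkill r hr))
      ((toWreath_right c b r).trans (hR r hr))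
  let Φ := PresentedGroup.toGroup hrel
  have hΦ (g : FreeGroup X) : Φ (PresentedGroup.mk R g) = toWreath c b g := rfl
  have hequiv (g : PresentedGroup R) (k q : ℤ) :
      (Φ g).left (k + N * q) = T ^ q * (Φ g).left k * (T ^ q)⁻¹ := by
    obtain ⟨g, rfl⟩ := PresentedGroup.mk_surjective R g
    exact equivariant_mul (cocycle_equivariant c b (twist_add hα) g) q k
  let ρ : PresentedGroup R →* Multiplicative (ZMod N) :=
    (AddMonoidHom.toMultiplicative (Int.castAddHom (ZMod N))).comp
      (SemidirectProduct.rightHom.comp Φ)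
  have hρ (g : PresentedGroup R) : g ∈ ρ.ker ↔ (N : ℤ) ∣ (Φ g).right.toAdd := by
    rw [← ZMod.intCast_zmod_eq_zero_iff_dvd]
    rfl
  -- Multiplying elements of heights `N q` and `N q'` translates the second sequence by `N q`, i.e.
  -- conjugates it by `T ^ q`; the factor `T ^ q` absorbs this.
  let f : ρ.ker →* TwistGroup p :=
    { toFun := fun g => (Φ g).left 0 * T ^ ((Φ g).right.toAdd / N)
      map_one' := by simp
      map_mul' := fun g h => by
        obtain ⟨q, hq⟩ := (hρ g).1 g.2
        have h1 := hequiv h 0 q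
        simp only [Subgroup.coe_mul, map_mul, SemidirectProduct.mul_left,
          SemidirectProduct.mul_right, Pi.mul_apply, translation_apply, toAdd_mul]
        rw [hq, h1, Int.add_ediv_of_dvd_left (Dvd.intro _ rfl), Int.mul_ediv_cancel_left _ hN,
          zpow_add]
        group }
  have hpow (m : ℤ) : toWreath c b (FreeGroup.of x₀ ^ m) =
      SemidirectProduct.inr (Multiplicative.ofAdd m) := by
    have hb₀ : b x₀ = 1 := funext fun k => twist_eq_one (h₀ k)
    have : toWreath c b (FreeGroup.of x₀) = SemidirectProduct.inr (Multiplicative.ofAdd 1) := by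
      rw [toWreath, FreeGroup.lift_apply_of, hb₀, hc]; rfl
    rw [map_zpow, this, ← map_zpow, ← ofAdd_zsmul]; simp
  have hpow_left (m k : ℤ) : cocycle c b (FreeGroup.of x₀ ^ m) k = 1 := by
    rw [cocycle, hpow]; rfl
  let t : FreeGroup X := FreeGroup.of x₀ ^ (N : ℤ)
  -- The powers of `x₀` carry no cocycle value: the left one moves the reading of `x₁` to position
  -- `k₁`, the right one restores height `0`.
  let y : FreeGroup X :=
    FreeGroup.of x₀ ^ (k₁ : ℤ) * FreeGroup.of x₁ * FreeGroup.of x₀ ^ (-c x₁ - k₁)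
  have hhy : height c y = 1 := by
    apply Multiplicative.toAdd.injective
    simp only [y, map_mul, map_zpow, toAdd_mul, toAdd_zpow, height_of, hc, smul_eq_mul, toAdd_one]
    ring
  have hy : cocycle c b y 0 = SemidirectProduct.inr (Multiplicative.ofAdd (α x₁ k₁)) := by
    rw [cocycle_mul, cocycle_mul, hpow_left, hpow_left, cocycle_of]
    simp only [map_zpow, toAdd_zpow, height_of, hc, smul_eq_mul, mul_one, one_mul, zero_add]
    exact twist_eq_of_lt α x₁ (by positivity) (by exact_mod_cast hk₁)
  let t' : ρ.ker := ⟨PresentedGroup.mk R t, by rw [hρ, hΦ, hpow]; simp⟩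
  let y' : ρ.ker := ⟨PresentedGroup.mk R y, by rw [hρ, hΦ, toWreath_right, hhy]; simp⟩
  have hft : f t' = SemidirectProduct.inl (FreeGroup.of 0) := by
    change (toWreath c b t).left 0 * T ^ ((toWreath c b t).right.toAdd / N) = _
    rw [hpow]
    simp [Int.ediv_self hN, hT, twistGen]
  have hfy : f y' = SemidirectProduct.inr (Multiplicative.ofAdd (α x₁ k₁)) := by
    change cocycle c b y 0 * T ^ ((toWreath c b y).right.toAdd / N) = _
    rw [hy, toWreath_right, hhy]
    simp
  -- Conjugating the basis element `0` by the element `α x₁ k₁` of `ℤ/p` gives the basis element `α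
  -- x₁ k₁`, which is different since `α x₁ k₁ ≠ 0`.
  refine isLarge_of_hom_semidirectProduct ρ.ker f t' (y' * t' * y'⁻¹)
    (u := FreeGroup.of 0) (v := FreeGroup.of (α x₁ k₁)) hft ?_ ?_
  · rw [map_mul, map_mul, map_inv, hft, hfy, ← map_inv, ← SemidirectProduct.inl_aut, rotation_of]
    simp
  · intro h
    have := congrArg FreeGroup.toWord h
    simp [FreeGroup.toWord_mul, FreeGroup.reduce.cons] at this
    exact h₁ this.2

/-- The cocycle of `α` vanishes on `r` if `α` vanishes near the multiples of `N` and satisfies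
the linear equations given by `r`. -/
theorem cocycle_twist_eq_one [NeZero N] {c : X → ℤ} {α : X → ℤ → ZMod p}
    (hα : ∀ x k, α x (k + N) = α x k) {s : ℕ}
    (hs : ∀ x (k : ℤ), k % N < s ∨ N - s ≤ k % N → α x k = 0) (hsN : s ≤ N)
    {B : Type} [Group B] (η : B →* TwistGroup p) (b : X → ℤ → B)
    (hη : ∀ x k, η (b x k) = SemidirectProduct.inr (Multiplicative.ofAdd (α x k)))
    {r : FreeGroup X}
    (hr : ∀ k : ℤ, (∀ j : ℤ, |j| ≤ s → ∀ x, twist N α x (k + j) = η (b x (k + j))) →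
      cocycle c (twist N α) r k = η (cocycle c b r k))
    (heq : ∀ k : ℕ, k < N → η (cocycle c b r k) = 1) (k : ℤ) :
    cocycle c (twist N α) r k = 1 := by
  have hN : (0 : ℤ) < N := by exact_mod_cast NeZero.pos N
  have hbase (k : ℕ) (hk : k < N) : cocycle c (twist N α) r k = 1 := by
    rw [hr, heq k hk]
    intro j hj x
    rw [abs_le] at hj
    rw [hη]
    -- Inside the base period the conjugator is trivial. Outside it, `k + j` is within `s` of a
    -- multiple of `N`, so `α` vanishes and the conjugator is irrelevant.
    by_cases h : 0 ≤ (k : ℤ) + j ∧ (k : ℤ) + j < N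
    · exact twist_eq_of_lt α x h.1 h.2
    · have h0 : α x (k + j) = 0 := by
        apply hs
        rcases not_and_or.1 h with h | h
        · right
          rw [← Int.add_emod_right, Int.emod_eq_of_lt] <;> omega
        · left
          rw [← Int.sub_emod_right, Int.emod_eq_of_lt] <;> omega
      rw [twist_eq_one h0, h0]; simp
  obtain ⟨m, hm⟩ := Int.eq_ofNat_of_zero_le (Int.emod_nonneg k hN.ne')
  have hlt := Int.emod_lt_of_pos k hN
  have := equivariant_mul (cocycle_equivariant c _ (twist_add hα) r) (k / N) (k % N)
  rw [Int.emod_add_mul_ediv] at this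
  rw [this, hm, hbase m (by omega)]
  simp

/-! ### Linear equations over `ℤ/p` and their solutions supported in a window -/

/-- Evaluation at `x` and `k`, as a generator of the universal linear cocycle. -/
def evalGen (X : Type) (p : ℕ) (x : X) (k : ℤ) : Multiplicative ((X → ℤ → ZMod p) →+ ZMod p) :=
  Multiplicative.ofAdd
    ((Pi.evalAddMonoidHom (fun _ : ℤ => ZMod p) k).comp (Pi.evalAddMonoidHom _ x))

/-- The specialization of the universal linear cocycle at `α`. -/
def specialization (α : X → ℤ → ZMod p) :
    Multiplicative ((X → ℤ → ZMod p) →+ ZMod p) →* TwistGroup p :=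
  SemidirectProduct.inr.comp (AddMonoidHom.toMultiplicative (AddMonoidHom.eval α))

/-- The linear form in `α` whose vanishing is the equation given by `r` at `k`. -/
def linearForm (p : ℕ) (c : X → ℤ) (r : FreeGroup X) (k : ℤ) : (X → ℤ → ZMod p) →+ ZMod p :=
  (cocycle c (evalGen X p) r k).toAdd

/-- Extension of a function on a window of length `L` to a function of period `L + 2 * s`. -/
def periodize [DecidableEq X] (p : ℕ) (x₀ : X) (s L : ℕ) :
    ({x // x ≠ x₀} × Fin L → ZMod p) →+ (X → ℤ → ZMod p) where
  toFun u x k :=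
    if h : x ≠ x₀ ∧ s ≤ (k % (L + 2 * s : ℕ)).toNat ∧ (k % (L + 2 * s : ℕ)).toNat < s + L then
      u (⟨x, h.1⟩, ⟨(k % (L + 2 * s : ℕ)).toNat - s, by omega⟩) else 0
  map_zero' := by ext x k; simp
  map_add' u v := by
    ext x k
    simp only [Pi.add_apply]
    split_ifs <;> simp

theorem exists_radius_of_finite (A B : Type*) [Group A] [Group B] (c : X → ℤ) {ι : Type*}
    [Finite ι] (r : ι → FreeGroup X) :
    ∃ s : ℕ, ∀ (i : ι) (b : X → ℤ → A) (b' : X → ℤ → B) (η : B →* A) (k : ℤ),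
      (∀ j : ℤ, |j| ≤ s → ∀ x, b x (k + j) = η (b' x (k + j))) →
        cocycle c b (r i) k = η (cocycle c b' (r i) k) := by
  cases nonempty_fintype ι
  choose s hs using fun i => exists_radius A B c (r i)
  refine ⟨∑ i, s i, fun i b b' η k h => hs i b b' η k fun j hj => h j (hj.trans ?_)⟩
  exact_mod_cast Finset.single_le_sum (fun _ _ => Nat.zero_le _) (Finset.mem_univ i)

/-- For finitely many relators of height `0` there is a margin `s` such that the presented group is
large as soon as some non-zero function, supported in a window, satisfies the linear equations. -/
theorem exists_margin [DecidableEq X] [NeZero p] {ι : Type} [Finite ι]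
    (r : ι → FreeGroup X) {c : X → ℤ} {x₀ : X} (hc : c x₀ = 1)
    (hr : ∀ i, height c (r i) = 1) :
    ∃ s : ℕ, ∀ (L : ℕ) (u : {x // x ≠ x₀} × Fin L → ZMod p), u ≠ 0 →
      (∀ i, ∀ k < L + 2 * s, linearForm p c (r i) (k : ℕ) (periodize p x₀ s L u) = 0) →
        IsLarge (PresentedGroup (Set.range r)) := by
  -- The radius compares the twisted cocycle with the universal linear one; it depends only on `r`
  -- and `c`, so `L` can be chosen afterwards.
  obtain ⟨s, hs⟩ := exists_radius_of_finite (TwistGroup p)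
    (Multiplicative ((X → ℤ → ZMod p) →+ ZMod p)) c r
  refine ⟨s, fun L u hu hlin => ?_⟩
  obtain ⟨⟨⟨x₁, hx₁⟩, l⟩, hne⟩ := Function.ne_iff.1 hu
  have hl := l.2
  set N := L + 2 * s with hN
  have : NeZero N := ⟨by omega⟩
  set α := periodize p x₀ s L u with hα
  have hper : ∀ x k, α x (k + N) = α x k := fun x k => by
    simp only [hα, periodize, AddMonoidHom.coe_mk, ZeroHom.coe_mk, ← hN, Int.add_emod_right]
  have hval : α x₁ (s + l : ℕ) = u (⟨x₁, hx₁⟩, l) := by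
    have : (((s + l : ℕ) : ℤ) % (L + 2 * s : ℕ)).toNat = s + l := by
      rw [Int.emod_eq_of_lt] <;> omega
    simp only [hα, periodize, AddMonoidHom.coe_mk, ZeroHom.coe_mk, this]
    rw [dif_pos ⟨hx₁, by omega, by omega⟩]
    congr
    omega
  refine isLarge_of_cocycle_twist (N := N) (p := p) (α := α) (x₁ := x₁) (k₁ := s + l) hc ?_ hper
    ?_ (by omega) (by rw [hval]; exact hne) ?_
  · rintro _ ⟨i, rfl⟩; exact hr i
  · intro k
    simp [hα, periodize]
  · rintro _ ⟨i, rfl⟩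
    refine cocycle_twist_eq_one hper (s := s) ?_ (by omega) (specialization α) (evalGen X p)
      (fun _ _ => rfl) (fun k => hs i _ _ _ k) ?_
    · intro x k hk
      have hpos := Int.emod_nonneg k (b := N) (by omega)
      simp only [hα, periodize, AddMonoidHom.coe_mk, ZeroHom.coe_mk, ← hN]
      rw [dif_neg]
      omega
    · intro k hk
      change SemidirectProduct.inr (Multiplicative.ofAdd (linearForm p c (r i) k α)) = 1
      rw [hlin i k hk]
      simp

/-- A group with at least two more generators than relators is large, provided that the relators
have height `0` for some choice of heights for which one generator has height `1`. -/
theorem isLarge_of_deficiency [Fintype X] {ι : Type} [Fintype ι]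
    (hcard : Fintype.card ι + 2 ≤ Fintype.card X) (r : ι → FreeGroup X) {c : X → ℤ} {x₀ : X}
    (hc : c x₀ = 1) (hr : ∀ i, height c (r i) = 1) :
    IsLarge (PresentedGroup (Set.range r)) := by
  classical
  obtain ⟨s, hs⟩ := exists_margin (p := 2) r hc hr
  set m := Fintype.card ι
  -- There are at least `(m + 1) * L` unknowns and `m * (L + 2 * s)` equations, so `L > 2 * s * m`
  -- is what is needed.
  set L := 2 * s * m + 1 with hL
  let f : ({x // x ≠ x₀} × Fin L → ZMod 2) → (ι × Fin (L + 2 * s) → ZMod 2) := fun u i =>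
    linearForm 2 c (r i.1) (i.2 : ℕ) (periodize 2 x₀ s L u)
  -- Pigeonhole on the finite sets of vectors over `ℤ/2` replaces a rank count; the difference of
  -- two colliding vectors is a solution.
  obtain ⟨u, v, huv, hf⟩ := Fintype.exists_ne_map_eq_of_card_lt f (by
    simp only [Fintype.card_fun, Fintype.card_prod, Fintype.card_fin, ZMod.card]
    apply Nat.pow_lt_pow_right one_lt_two
    have : m + 1 ≤ Fintype.card {x // x ≠ x₀} := by
      rw [Fintype.card_subtype_compl, Fintype.card_subtype_eq]; omega
    calc m * (L + 2 * s) < (m + 1) * L := by rw [hL]; ring_nf; omega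
      _ ≤ _ := Nat.mul_le_mul_right _ this)
  refine hs L (u - v) (sub_ne_zero.2 huv) fun i k hk => ?_
  rw [map_sub, map_sub, sub_eq_zero]
  exact congrFun hf (i, ⟨k, hk⟩)

/-- A one-relator group with at least two generators, whose relator is a proper power of a word of
height `0`, is large, provided that one generator has height `1`. -/
theorem isLarge_of_properPower {p : ℕ} (hp : 2 ≤ p) {v : FreeGroup X} {c : X → ℤ} {x₀ x₁ : X}
    (hx : x₁ ≠ x₀) (hc : c x₀ = 1) (hv : height c v = 1) : IsLarge (PresentedGroup {v ^ p}) := by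
  classical
  have : NeZero p := ⟨by omega⟩
  have : Fact (1 < p) := ⟨hp⟩
  obtain ⟨s, hs⟩ := exists_margin (p := p) (fun _ : Unit => v ^ p) hc (fun _ => by simp [hv])
  -- A window of length `1` with the constant function `1` works: the form of `v ^ p` is `p` times
  -- that of `v`, hence zero in `ℤ/p`.
  have hlarge := hs 1 1 (fun h => one_ne_zero (congrFun h (⟨x₁, hx⟩, 0))) fun i k _ => by
    rw [linearForm, cocycle_pow c _ hv, toAdd_pow, AddMonoidHom.nsmul_apply]
    simp
  rwa [Set.range_const] at hlarge

end Twist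

/-! ### Redundant cyclic presentations -/

section Redundant

variable {n : ℕ}

theorem shift_pow (n i : ℕ) : shift n ^ i = rotation n (Multiplicative.ofAdd (i : ZMod n)) := by
  have h : shift n = rotation n (Multiplicative.ofAdd 1) := rfl
  rw [h, ← map_pow, ← ofAdd_nsmul, nsmul_one]

theorem rotation_add (i j : ZMod n) (w : FreeGroup (ZMod n)) :
    rotation n (Multiplicative.ofAdd (i + j)) w =
      rotation n (Multiplicative.ofAdd i) (rotation n (Multiplicative.ofAdd j) w) := by
  rw [ofAdd_add, map_mul]; rfl

/-- In a redundant cyclic presentation either the defining word is trivial, or some proper shift of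
it is conjugate to it or to its inverse. -/
theorem IsRedundant.cases {w : FreeGroup (ZMod n)} (h : IsRedundant (cyclicRelators n w)) :
    w = 1 ∨ ∃ (d : ZMod n) (ε : ℤ), d ≠ 0 ∧ (ε = 1 ∨ ε = -1) ∧
      IsConj (rotation n (Multiplicative.ofAdd d) w) (w ^ ε) := by
  obtain ⟨_, ⟨i, -, rfl⟩, h⟩ := h
  rw [shift_pow] at h
  rcases h with h | ⟨_, ⟨j, -, rfl⟩, hne, h⟩
  · left
    simpa using h
  · right
    rw [shift_pow] at h hne
    have key (ε : ℤ) (h : IsConj (rotation n (Multiplicative.ofAdd (i : ZMod n)) w)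
        (rotation n (Multiplicative.ofAdd (j : ZMod n)) w ^ ε)) :
        IsConj (rotation n (Multiplicative.ofAdd (-j + i : ZMod n)) w) (w ^ ε) := by
      have := (rotation n (Multiplicative.ofAdd (-j : ZMod n))).toMonoidHom.map_isConj h
      simp only [MulEquiv.coe_toMonoidHom, map_zpow, ← rotation_add] at this
      simpa using this
    have hd : (-j + i : ZMod n) ≠ 0 := by
      intro h0
      rw [neg_add_eq_zero] at h0
      exact hne (by rw [h0])
    rcases h with h | h
    · exact ⟨_, 1, hd, Or.inl rfl, key 1 (by simpa using h)⟩
    · exact ⟨_, -1, hd, Or.inr rfl, key (-1) (by simpa using h)⟩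

variable {w : FreeGroup (ZMod n)} {d : ZMod n} {ε : ℤ}

/-- Shifts by multiples of `d` of a relator are consequences of it. -/
theorem rotation_mem_normalClosure
    (h : IsConj (rotation n (Multiplicative.ofAdd d) w) (w ^ ε)) (i : ZMod n) (k : ℕ) :
    rotation n (Multiplicative.ofAdd (i + k • d)) w ∈
      Subgroup.normalClosure {rotation n (Multiplicative.ofAdd i) w} := by
  induction k with
  | zero => simpa using Subgroup.subset_normalClosure (Set.mem_singleton _)
  | succ k ih =>
    have h1 := (rotation n (Multiplicative.ofAdd (i + k • d))).toMonoidHom.map_isConj h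
    simp only [MulEquiv.coe_toMonoidHom, map_zpow, ← rotation_add] at h1
    obtain ⟨g, hg⟩ := isConj_iff.1 h1.symm
    rw [succ_nsmul, ← add_assoc, ← hg]
    exact Subgroup.normalClosure_normal.conj_mem _ (Subgroup.zpow_mem _ ih ε) g

/-- Heights for which the relators of a redundant cyclic presentation have height `0`. -/
theorem exists_height (hd : d ≠ 0)
    (h : IsConj (rotation n (Multiplicative.ofAdd d) w) (w ^ ε)) :
    ∃ c : ZMod n → ℤ, c 0 = 1 ∧
      ∀ i, height c (rotation n (Multiplicative.ofAdd i) w) = 1 := by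
  -- Exponent sum in `x_0` minus `ε` times that in `x_d`. For `u` a shift of `w`, the exponent sum
  -- of `u` in `x_0` is that of its `d`-shift in `x_d`, and this shift is conjugate to `u ^ ε`.
  refine ⟨fun x => (Pi.single 0 1 : ZMod n → ℤ) x - ε * (Pi.single d 1 : ZMod n → ℤ) x, ?_,
    fun i => ?_⟩
  · simp [Pi.single_eq_of_ne hd.symm]
  · have h1 : height (fun x => (Pi.single 0 1 : ZMod n → ℤ) x -
        ε * (Pi.single d 1 : ZMod n → ℤ) x) = height (Pi.single 0 1 : ZMod n → ℤ) *
          (height (Pi.single d 1 : ZMod n → ℤ) ^ ε)⁻¹ := by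
      ext x
      simp only [height, FreeGroup.lift_apply_of, MonoidHom.mul_apply, MonoidHom.inv_apply,
        MonoidHom.zpow_apply, ← ofAdd_zsmul, ← ofAdd_neg, ← ofAdd_add, smul_eq_mul, sub_eq_add_neg]
    have h2 (u : FreeGroup (ZMod n)) : height (Pi.single d 1 : ZMod n → ℤ)
        (rotation n (Multiplicative.ofAdd d) u) = height (Pi.single 0 1 : ZMod n → ℤ) u := by
      have : (height (Pi.single d 1 : ZMod n → ℤ)).comp
          (rotation n (Multiplicative.ofAdd d)).toMonoidHom =
            height (Pi.single 0 1 : ZMod n → ℤ) := by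
        ext x
        simp [height, rotation_of, Pi.single_apply]
      exact DFunLike.congr_fun this u
    set u := rotation n (Multiplicative.ofAdd i) w with hu
    have h3 := (rotation n (Multiplicative.ofAdd i)).toMonoidHom.map_isConj h
    simp only [MulEquiv.coe_toMonoidHom, map_zpow, ← rotation_add, ← hu] at h3
    rw [add_comm, rotation_add, ← hu] at h3
    have h4 := isConj_iff_eq.1 ((height (Pi.single d 1 : ZMod n → ℤ)).map_isConj h3)
    rw [h2, map_zpow] at h4
    rw [h1, MonoidHom.mul_apply, MonoidHom.inv_apply, h4, MonoidHom.zpow_apply, mul_inv_cancel]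

/-- One relator per coset of `⟨d⟩` implies the others. As `⟨d⟩` has at least two elements, there are
at most `n / 2` cosets, and this leaves deficiency at least two once `n ≥ 3`. -/
theorem isLarge_of_isConj [NeZero n] (hn : 3 ≤ n) (hd : d ≠ 0)
    (h : IsConj (rotation n (Multiplicative.ofAdd d) w) (w ^ ε)) :
    IsLarge (CyclicGroup n w) := by
  classical
  obtain ⟨c, hc, hht⟩ := exists_height hd h
  let D := AddSubgroup.zmultiples d
  have : Fintype (ZMod n ⧸ D) := Fintype.ofFinite _
  have hcard : Fintype.card (ZMod n ⧸ D) + 2 ≤ Fintype.card (ZMod n) := by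
    have h1 := D.card_eq_card_quotient_mul_card_addSubgroup
    have h2 : 1 < Nat.card D := by
      have : Nontrivial D := D.nontrivial_iff_exists_ne_zero.2
        ⟨d, AddSubgroup.mem_zmultiples d, hd⟩
      exact Finite.one_lt_card
    rw [Nat.card_zmod, Nat.card_eq_fintype_card (α := ZMod n ⧸ D)] at h1
    rw [ZMod.card]
    have := Nat.mul_le_mul_left (Fintype.card (ZMod n ⧸ D)) h2
    omega
  refine (isLarge_of_deficiency hcard
    (fun q => rotation n (Multiplicative.ofAdd q.out) w) hc (fun q => hht _)).of_relators ?_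
  rintro _ ⟨i, -, rfl⟩
  rw [shift_pow]
  set q : ZMod n ⧸ D := QuotientAddGroup.mk (i : ZMod n) with hq
  have hmem : -q.out + (i : ZMod n) ∈ D := QuotientAddGroup.eq.1 (Quotient.out_eq q)
  obtain ⟨k, hk⟩ := mem_multiples_iff_mem_zmultiples.2 hmem
  have h1 := rotation_mem_normalClosure h q.out k
  rw [show q.out + k • d = (i : ZMod n) by
    rw [show k • d = -q.out + (i : ZMod n) from hk]; abel] at h1
  exact Subgroup.normalClosure_mono (Set.singleton_subset_iff.2 (Set.mem_range_self q)) h1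

/-- For `n = 2` the deficiency is only one, but `w` alone implies both relators. Its root has height
`0` because `ℤ` is torsion-free. -/
theorem isLarge_of_isConj_of_isProperPower {w : FreeGroup (ZMod 2)} {d : ZMod 2} (hd : d ≠ 0)
    (h : IsConj (rotation 2 (Multiplicative.ofAdd d) w) (w ^ ε)) (hw : IsProperPower w) :
    IsLarge (CyclicGroup 2 w) := by
  obtain ⟨c, hc, hht⟩ := exists_height hd h
  obtain ⟨v, p, hp, rfl⟩ := hw
  have hv : height c v = 1 := by
    have := congrArg Multiplicative.toAdd (hht 0)
    simp only [ofAdd_zero, map_one, MulAut.one_apply, map_pow, toAdd_pow, toAdd_one,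
      smul_eq_zero] at this
    exact Multiplicative.toAdd.injective (this.resolve_left (by omega))
  refine (isLarge_of_properPower hp (x₀ := 0) (x₁ := 1) one_ne_zero hc hv).of_relators ?_
  rintro _ ⟨i, -, rfl⟩
  rw [shift_pow]
  obtain ⟨k, hk⟩ : ∃ k : ℕ, k • d = (i : ZMod 2) := by
    generalize (i : ZMod 2) = j
    have : ∀ d j : ZMod 2, d ≠ 0 → ∃ k ∈ Finset.range 2, k • d = j := by decide
    obtain ⟨k, -, hk⟩ := this d j hd
    exact ⟨k, hk⟩
  have h1 := rotation_mem_normalClosure h 0 k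
  rwa [zero_add, hk, ofAdd_zero, map_one, MulAut.one_apply] at h1

theorem isLarge_of_eq_one [NeZero n] (hn : 2 ≤ n) : IsLarge (CyclicGroup n 1) := by
  refine (isLarge_of_deficiency (ι := Empty) (by simpa [ZMod.card] using hn) Empty.elim
    (c := fun _ => 1) (x₀ := (0 : ZMod n)) rfl nofun).of_relators ?_
  rintro _ ⟨i, -, rfl⟩
  rw [map_one]
  exact one_mem _

end Redundant

/-! ### Special presentations have at least three generators -/

section Special

variable {α β : Type*} {G : Graph α β}

theorem isPath_of_isLink_of_isLink {e f : β} {x y : α} (he : G.IsLink e x y)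
    (hf : G.IsLink f y x) : IsPath G 2 ![x, y, x] ![e, f] := by
  refine ⟨he.left_mem, fun i => ?_⟩
  fin_cases i
  · exact he
  · exact hf

/-- There are no double edges in a graph of girth greater than `2`. -/
theorem eq_of_isLink_of_egirth (hG : 2 < egirth G) {e f : β} {x y : α} (he : G.IsLink e x y)
    (hf : G.IsLink f x y) : e = f := by
  by_contra hne
  refine hG.not_ge (iInf₂_le_of_le 2 ⟨two_pos, ![x, y, x], ![e, f],
    isPath_of_isLink_of_isLink he hf.symm, rfl, ?_⟩ le_rfl)
  intro i j hij
  have hi : i = 0 := by omega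
  have hj : j = 1 := by omega
  subst hi hj
  exact hne

/-- Without loops and double edges, the degree is at most the number of neighbours. -/
theorem edegree_le_encard (hG : 2 < egirth G) (x : α) (hl : ∀ e, ¬ G.IsLoopAt e x) :
    edegree G x ≤ {y | ∃ e, G.IsLink e x y}.encard := by
  have h0 : {e | G.IsLoopAt e x} = ∅ := Set.eq_empty_iff_forall_notMem.2 hl
  rw [edegree, h0, Set.encard_empty, add_zero]
  have h (e : {e | G.Inc e x}) : ∃ y, G.IsLink e x y := e.2
  choose f hf using h
  refine Function.Embedding.encard_le ⟨fun e => ⟨f e, e, hf e⟩, fun a b hab => ?_⟩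
  have hab' : f a = f b := congrArg Subtype.val hab
  exact Subtype.ext (eq_of_isLink_of_egirth hG (hf a) (hab' ▸ hf b))

/-- A non-empty bipartite graph of girth greater than `2` whose degrees are at least `3` has at
least six vertices. -/
theorem six_le_encard (hG : 2 < egirth G) (hb : IsBipartite G)
    (hdeg : ∀ x ∈ G.vertexSet, 3 ≤ edegree G x) {x : α} (hx : x ∈ G.vertexSet) :
    6 ≤ (Set.univ : Set α).encard := by
  obtain ⟨A, B, hAB, -, hlink⟩ := hb
  have hl (x e) : ¬ G.IsLoopAt e x := fun h => by
    rcases hlink e x x h with ⟨h1, h2⟩ | ⟨h1, h2⟩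
    · exact hAB.notMem_of_mem_left h1 h2
    · exact hAB.notMem_of_mem_left h2 h1
  have hnbr (x) (hx : x ∈ G.vertexSet) : 3 ≤ {y | ∃ e, G.IsLink e x y}.encard :=
    (hdeg x hx).trans (edegree_le_encard hG x (hl x))
  obtain ⟨y, e, he⟩ : {y | ∃ e, G.IsLink e x y}.Nonempty := by
    rw [← Set.encard_pos]
    exact lt_of_lt_of_le (by norm_num) (hnbr x hx)
  -- The ends of an edge lie in opposite classes, hence so do their neighbours; three on each side
  -- make six vertices.
  have hdisj : Disjoint {z | ∃ e, G.IsLink e x z} {z | ∃ e, G.IsLink e y z} := by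
    rw [Set.disjoint_left]
    rintro z ⟨f, hf⟩ ⟨g, hg⟩
    have h1 := hlink _ _ _ he
    have h2 := hlink _ _ _ hf
    have h3 := hlink _ _ _ hg
    have h4 (v) (hA : v ∈ A) (hB : v ∈ B) : False := hAB.notMem_of_mem_left hA hB
    have h5 := h4 x
    have h6 := h4 y
    have h7 := h4 z
    tauto
  calc (6 : ℕ∞) = 3 + 3 := by norm_num
    _ ≤ _ := add_le_add (hnbr x hx) (hnbr y he.right_mem)
    _ = _ := (Set.encard_union_eq hdisj).symm
    _ ≤ _ := Set.encard_le_encard (Set.subset_univ _)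

/-- The vertices of the star graph are the `2 |X|` letters, and a component of girth `2 m ≥ 4`
already forces six of them. -/
theorem IsSpecial.three_le_card {X : Type*} [DecidableEq X] [Nonempty X] {m k ν : ℕ}
    {R : Set (FreeGroup X)} (h : IsSpecial m k ν R) : 3 ≤ Nat.card X := by
  have := h.finite_generators
  obtain ⟨x⟩ := ‹Nonempty X›
  let v : X × Bool := (x, true)
  let H := (starGraph R).induce {y | ∃ l, JoinedBy (starGraph R) l v y}
  have hH : H ∈ components (starGraph R) := ⟨v, Set.mem_univ _, rfl⟩
  have hv : v ∈ H.vertexSet :=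
    ⟨0, fun _ => v, Fin.elim0, ⟨Set.mem_univ _, fun i => i.elim0⟩, rfl, rfl⟩
  have hg : 2 < egirth H := by
    rw [h.girth H hH]
    have := h.two_le_m
    exact_mod_cast (by omega : 2 < 2 * m)
  have h6 := six_le_encard hg (h.bipartite H hH) (h.degree H hH) hv
  rw [Set.encard_univ, ENat.card_eq_coe_natCard, Nat.card_prod, Nat.card_eq_fintype_card (α := Bool),
    Fintype.card_bool] at h6
  have : 6 ≤ Nat.card X * 2 := by exact_mod_cast h6
  omega

end Special

end CyclicPres

theorem theorem4p1 (n : ℕ) (hn : 1 ≤ n) (w : FreeGroup (ZMod n))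
    (hw : FreeGroup.IsCyclicallyReduced w.toWord)
    (hred : CyclicPres.IsRedundant (CyclicPres.cyclicRelators n w)) :
    ((3 ≤ n ∨ (n = 2 ∧ CyclicPres.IsProperPower w)) →
        CyclicPres.IsLarge (CyclicPres.CyclicGroup n w)) ∧
      ((∃ m k ν : ℕ, CyclicPres.IsSpecial m k ν (CyclicPres.cyclicRelators n w)) →
        CyclicPres.IsLarge (CyclicPres.CyclicGroup n w)) := by
  have : NeZero n := ⟨by omega⟩
  have main : (3 ≤ n ∨ (n = 2 ∧ CyclicPres.IsProperPower w)) →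
      CyclicPres.IsLarge (CyclicPres.CyclicGroup n w) := by
    intro h
    rcases hred.cases with rfl | ⟨d, ε, hd, -, hconj⟩
    · exact CyclicPres.isLarge_of_eq_one (by omega)
    · rcases h with h | ⟨rfl, hpow⟩
      · exact CyclicPres.isLarge_of_isConj h hd hconj
      · exact CyclicPres.isLarge_of_isConj_of_isProperPower hd hconj hpow
  refine ⟨main, ?_⟩
  rintro ⟨m, k, ν, h⟩
  -- Special presentations have `n ≥ 3`, so the proper power case does not arise.
  exact main (Or.inl (by simpa using h.three_le_card))
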